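/- Let $p$ be a prime, let $t\ge 1$, and let $b_1,\dots,b_t\in\mathbb F_p[X]$ be monic, nonconstant and pairwise coprime. For a formal Laurent series $L=\sum_{i\ge w}a_iX^{-i}\in\mathbb F_p((X^{-1}))$ with $a_w\ne 0$ put $\nu(L)=-w$, and $\nu(0)=-\infty$. Let $\mathcal H=\{L\in\mathbb F_p((X^{-1})):\nu(L)<0\}$, a compact additive group in the valuation topology, and let $\mathfrak h$ be its normalized Haar measure. For $L\in\mathbb F_p((X^{-1}))$ let $L=[A_0(L);A_1(L),A_2(L),\dots]$ be its continued fraction expansion, with $A_h(L)\in\mathbb F_p[X]$ and $\deg A_h(L)\ge 1$ for $h\ge 1$; it is finite exactly if $L$ is rational, and terms with $h$ beyond the end of the expansion are counted as $0$ in the sum below. Then for $\mathfrak h$-almost all $L\in\mathcal H$ and every real $\epsilon>0$ there is a constant $C$, which depends only on $p,t,b_1,\dots,b_t,L,\epsilon$, such that for all integers $N>1$ $$\sum_{h=1}^{\lfloor\log_pN\rfloor}\ \sum_{l_1=1}^{\lfloor\log_pN\rfloor}\cdots\sum_{l_t=1}^{\lfloor\log_pN\rfloor}\deg\bigl(A_h(b_1^{l_1}\cdots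 b_t^{l_t}L)\bigr)\,p^{\deg(A_h(b_1^{l_1}\cdots b_t^{l_t}L))}\ \le\ C\,(\log N)^{t+1+\epsilon}.$$ -/

import Mathlib

open scoped LaurentSeries Polynomial

noncomputable section

namespace FunctionFieldCF

variable (p : ℕ)

/-- The field `𝔽_p((X⁻¹))` of formal Laurent series in `X⁻¹`. Mathlib's `LaurentSeries` has one
formal variable, which here stands for `X⁻¹`: the coefficient `L.coeff i` is the coefficient of
`X⁻ⁱ` in `L = ∑_{i ≥ w} a_i X⁻ⁱ`. -/
abbrev LaurentInv : Type := LaurentSeries (ZMod p)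

variable {p}

/-- The degree valuation `ν` on `𝔽_p((X⁻¹))`: if `L = ∑_{i ≥ w} a_i X⁻ⁱ` with `a_w ≠ 0` then
`ν L = -w`; and `ν 0 = -∞`. -/
def nu (L : LaurentInv p) : WithBot ℤ :=
  open Classical in if L = 0 then ⊥ else ((-L.order : ℤ) : WithBot ℤ)

theorem nu_lt_zero_iff (L : LaurentInv p) : nu L < 0 ↔ ∀ i : ℤ, i ≤ 0 → L.coeff i = 0 := by
  unfold nu
  split_ifs with h
  · simp [h]
  · have h0 : (((-L.order : ℤ) : WithBot ℤ) < 0) ↔ -L.order < 0 := by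
      exact_mod_cast WithBot.coe_lt_coe (a := -L.order) (b := 0)
    rw [h0]
    constructor
    · intro hw i hi
      exact HahnSeries.coeff_eq_zero_of_lt_order (by omega)
    · intro hc
      by_contra hw
      exact HahnSeries.coeff_order_eq_zero.not.2 h (hc _ (by omega))

/-- The embedding `𝔽_p[X] → 𝔽_p((X⁻¹))`, sending `X` to `(X⁻¹)⁻¹`. -/
def polyToLaurent : (ZMod p)[X] →+* LaurentInv p :=
  Polynomial.eval₂RingHom HahnSeries.C (HahnSeries.single (-1 : ℤ) (1 : ZMod p))

/-- The polynomial part `∑_{n ≥ 0} a_{-n} Xⁿ` of `L = ∑_i a_i X⁻ⁱ`. -/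
def polyPart (L : LaurentInv p) : (ZMod p)[X] :=
  ∑ n ∈ Finset.range ((-L.order).toNat + 1), Polynomial.monomial n (L.coeff (-(n : ℤ)))

/-- The finite sum defining `polyPart` catches all nonnegative powers of `X`. -/
theorem coeff_polyPart (L : LaurentInv p) (n : ℕ) :
    (polyPart L).coeff n = L.coeff (-(n : ℤ)) := by
  simp only [polyPart, Polynomial.finsetSum_coeff, Polynomial.coeff_monomial]
  rw [Finset.sum_ite_eq']
  split_ifs with h
  · rfl
  · rw [Finset.mem_range] at h
    exact (HahnSeries.coeff_eq_zero_of_lt_order (by omega)).symm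

section Prime

variable [Fact p.Prime]

/-- The complete quotients of the continued fraction expansion of `L`: `α₀ = L` and
`α_{h+1} = 1 / (α_h - A_h)`, where `A_h` is the polynomial part of `α_h`. The expansion stops when
`α_h = A_h` (this happens exactly for rational `L`); all later quotients are `0` here. -/
def completeQuotient (L : LaurentInv p) : ℕ → LaurentInv p
  | 0 => L
  | h + 1 => (completeQuotient L h - polyToLaurent (polyPart (completeQuotient L h)))⁻¹

/-- The continued fraction coefficient `A_h(L)` in `L = [A₀; A₁, A₂, …]`
(`0` if the expansion stops before `h`). -/
def cfCoeff (L : LaurentInv p) (h : ℕ) : (ZMod p)[X] :=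
  polyPart (completeQuotient L h)

variable (p)

/-- `𝓗`: the additive group of all `L ∈ 𝔽_p((X⁻¹))` with `ν L < 0`. It carries the subspace
topology of the valuation topology of `𝔽_p((X⁻¹))`. -/
def H : AddSubgroup (LaurentInv p) where
  carrier := {L | nu L < 0}
  zero_mem' := by simp [nu_lt_zero_iff]
  add_mem' := by
    intro a b ha hb
    simp only [Set.mem_ofPred_eq, nu_lt_zero_iff] at ha hb ⊢
    intro i hi
    simp [ha i hi, hb i hi]
  neg_mem' := by
    intro a ha
    simp only [Set.mem_ofPred_eq, nu_lt_zero_iff] at ha ⊢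
    intro i hi
    simp [ha i hi]

/-- The element `∑_{n ≥ 0} a_n X^{-(n+1)}` of `𝓗`. -/
def ofDigits (a : ℕ → ZMod p) : H p :=
  ⟨HahnSeries.ofPowerSeries ℤ (ZMod p) (PowerSeries.X * PowerSeries.mk a), by
    change nu _ < 0
    rw [nu_lt_zero_iff]
    intro i hi
    rw [PowerSeries.coeff_coe]
    rcases hi.lt_or_eq with h | h
    · simp [h]
    · simp [h]⟩

theorem coeff_ofDigits (a : ℕ → ZMod p) (n : ℕ) :
    (ofDigits p a : LaurentInv p).coeff ((n : ℤ) + 1) = a n := by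
  change (HahnSeries.ofPowerSeries ℤ (ZMod p) (PowerSeries.X * PowerSeries.mk a)).coeff _ = _
  have h : ((n : ℤ) + 1) = ((n + 1 : ℕ) : ℤ) := by push_cast; ring
  rw [h, LaurentSeries.coeff_coe_powerSeries, PowerSeries.coeff_succ_X_mul, PowerSeries.coeff_mk]

theorem ofDigits_surjective : Function.Surjective (ofDigits p) := by
  intro L
  refine ⟨fun n => (L : LaurentInv p).coeff ((n : ℤ) + 1), ?_⟩
  apply Subtype.ext
  ext i
  by_cases hi : i ≤ 0
  · rw [(nu_lt_zero_iff _).1 (ofDigits p _).2 i hi, (nu_lt_zero_iff _).1 L.2 i hi]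
  · obtain ⟨n, rfl⟩ : ∃ n : ℕ, i = (n : ℤ) + 1 := ⟨(i - 1).toNat, by omega⟩
    rw [coeff_ofDigits]

theorem continuous_ofDigits : Continuous (ofDigits p) := by
  rw [continuous_induced_rng, continuous_iff_continuousAt]
  intro a
  rw [ContinuousAt, Filter.tendsto_def]
  intro s hs
  obtain ⟨γ, hγ⟩ := Valued.mem_nhds.1 hs
  set g : WithZero (Multiplicative ℤ) := MonoidWithZeroHom.ValueGroup₀.embedding γ.1 with hg
  have hne : g ≠ 0 := by
    rw [hg, map_ne_zero]
    exact γ.ne_zero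
  obtain ⟨D, hD⟩ : ∃ D : ℕ, WithZero.exp (-(D : ℤ)) < g := by
    refine ⟨(1 - WithZero.log g).toNat, ?_⟩
    rw [← WithZero.lt_log_iff_exp_lt hne]
    omega
  have hopen : (Set.pi (Finset.range D : Set ℕ) fun n => ({a n} : Set (ZMod p))) ∈ nhds a :=
    set_pi_mem_nhds (Finset.finite_toSet _) fun n _ => by simp
  refine Filter.mem_of_superset hopen ?_
  intro b hb
  apply hγ
  rw [Set.mem_ofPred_eq, Valuation.restrict_lt_iff_lt_embedding]
  refine lt_of_le_of_lt ?_ hD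
  rw [LaurentSeries.valuation_le_iff_coeff_lt_eq_zero]
  intro i hi
  simp only [Function.comp_apply]
  rw [HahnSeries.coeff_sub]
  by_cases hi0 : i ≤ 0
  · rw [(nu_lt_zero_iff _).1 (ofDigits p _).2 i hi0, (nu_lt_zero_iff _).1 (ofDigits p _).2 i hi0,
      sub_zero]
  · obtain ⟨n, rfl⟩ : ∃ n : ℕ, i = (n : ℤ) + 1 := ⟨(i - 1).toNat, by omega⟩
    rw [coeff_ofDigits, coeff_ofDigits]
    have : b n = a n := hb n (by simp; omega)
    rw [this, sub_self]

instance : CompactSpace (H p) := by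
  rw [← isCompact_univ_iff, ← (ofDigits_surjective p).range_eq]
  exact isCompact_range (continuous_ofDigits p)

instance : MeasurableSpace (H p) := borel _

instance : BorelSpace (H p) := ⟨rfl⟩

/-- The normalized Haar measure on the compact group `𝓗` (total mass `1`). -/
def haarH : MeasureTheory.Measure (H p) :=
  MeasureTheory.Measure.addHaarMeasure (⊤ : TopologicalSpace.PositiveCompacts (H p))

end Prime

end FunctionFieldCF

end

/-! For a nonzero polynomial `P`, the map `L ↦ P L` modulo polynomials preserves Haar measure on `𝓗`
(`measurePreserving_mulFrac`), and so does the Gauss map `x ↦ frac (1 / x)`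
(`measurePreserving_gauss`). Hence for `h ≥ 1` the event `deg A_h(P L) ≥ d + 1` pulls back from a
cylinder of measure at most `p ^ (-d)`, uniformly in `P` and `h` (`haarH_natDegree_cfCoeff_ge`).

A variable `D * p ^ D` with such a tail may just fail to be integrable, but its moments of order `s
< 1` are bounded uniformly. Over a box of side `M` in dimension `n = t + 1`, the sum of the `s`-th
powers thus has mean `O(M ^ n)`. A weighted sum over dyadic `M` makes it almost surely `O(M ^ (n + ε
/ 2))`, and subadditivity of `x ^ s` returns to the original sum at the cost of an exponent `1 / s`
(`ae_exists_sum_mul_pow_le`). Only linearity of expectation is used, so the joint law of the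
summands plays no role. The theorem is the case `M = ⌊log_p N⌋`. -/

noncomputable section

namespace FunctionFieldCF

open MeasureTheory WithZero

/-! ### Fractional parts, the Gauss map and its conjugation to translations -/

section Algebra

variable {p : ℕ} [Fact p.Prime]

/-- The fractional part of `L`, as an element of `𝓗`. -/
def frac (L : LaurentInv p) : H p := ofDigits p fun n => L.coeff ((n : ℤ) + 1)

theorem coeff_H_of_nonpos (x : H p) {i : ℤ} (hi : i ≤ 0) : (x : LaurentInv p).coeff i = 0 :=
  (nu_lt_zero_iff _).1 x.2 i hi

theorem coeff_frac_of_pos (L : LaurentInv p) {i : ℤ} (hi : 0 < i) :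
    (frac L : LaurentInv p).coeff i = L.coeff i := by
  obtain ⟨n, rfl⟩ : ∃ n : ℕ, i = (n : ℤ) + 1 := ⟨(i - 1).toNat, by omega⟩
  rw [frac, coeff_ofDigits]

theorem H_ext {x y : H p} (h : ∀ i : ℤ, 0 < i →
    (x : LaurentInv p).coeff i = (y : LaurentInv p).coeff i) : x = y := by
  apply Subtype.ext
  ext i
  rcases le_or_gt i 0 with hi | hi
  · rw [coeff_H_of_nonpos x hi, coeff_H_of_nonpos y hi]
  · exact h i hi

theorem frac_add (L M : LaurentInv p) : frac (L + M) = frac L + frac M := by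
  refine H_ext fun i hi => ?_
  simp [coeff_frac_of_pos _ hi]

theorem frac_coe (x : H p) : frac (x : LaurentInv p) = x :=
  H_ext fun _ hi => coeff_frac_of_pos _ hi

theorem polyToLaurent_monomial (n : ℕ) (a : ZMod p) :
    polyToLaurent (Polynomial.monomial n a) = HahnSeries.single (-(n : ℤ)) a := by
  rw [polyToLaurent, Polynomial.coe_eval₂RingHom, Polynomial.eval₂_monomial,
    HahnSeries.single_pow, HahnSeries.C_apply, HahnSeries.single_mul_single]
  simp

theorem coeff_polyToLaurent_of_pos (P : (ZMod p)[X]) {i : ℤ} (hi : 0 < i) :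
    (polyToLaurent P).coeff i = 0 := by
  induction P using Polynomial.induction_on' with
  | add P Q hP hQ => simp [hP, hQ]
  | monomial n a =>
    rw [polyToLaurent_monomial, HahnSeries.coeff_single_of_ne (by omega)]

theorem coeff_polyToLaurent_neg (P : (ZMod p)[X]) (n : ℕ) :
    (polyToLaurent P).coeff (-(n : ℤ)) = P.coeff n := by
  induction P using Polynomial.induction_on' with
  | add P Q hP hQ => simp [hP, hQ]
  | monomial m a =>
    rw [polyToLaurent_monomial, Polynomial.coeff_monomial]
    split_ifs with h
    · rw [h, HahnSeries.coeff_single_same]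
    · rw [HahnSeries.coeff_single_of_ne (by omega)]

theorem polyToLaurent_ne_zero {P : (ZMod p)[X]} (hP : P ≠ 0) : polyToLaurent P ≠ 0 := by
  contrapose! hP
  ext n
  rw [← coeff_polyToLaurent_neg, hP]
  simp

theorem frac_polyToLaurent (P : (ZMod p)[X]) : frac (polyToLaurent P) = 0 := by
  refine H_ext fun i hi => ?_
  rw [coeff_frac_of_pos _ hi, coeff_polyToLaurent_of_pos _ hi]
  simp

theorem sub_polyPart_eq_frac (L : LaurentInv p) :
    L - polyToLaurent (polyPart L) = (frac L : LaurentInv p) := by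
  ext i
  rw [HahnSeries.coeff_sub]
  rcases le_or_gt i 0 with hi | hi
  · obtain ⟨n, rfl⟩ : ∃ n : ℕ, i = -(n : ℤ) := ⟨(-i).toNat, by omega⟩
    rw [coeff_H_of_nonpos _ hi, coeff_polyToLaurent_neg, coeff_polyPart, sub_self]
  · rw [coeff_frac_of_pos _ hi, coeff_polyToLaurent_of_pos _ hi, sub_zero]

theorem mem_H_iff {L : LaurentInv p} : L ∈ H p ↔ Valued.v L ≤ exp (-1 : ℤ) := by
  rw [LaurentSeries.valuation_le_iff_coeff_lt_eq_zero]
  exact (nu_lt_zero_iff L).trans ⟨fun h i hi => h i (by omega), fun h i hi => h i (by omega)⟩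

theorem valuation_lt_one (x : H p) : Valued.v (x : LaurentInv p) < 1 :=
  (mem_H_iff.1 x.2).trans_lt (by rw [← exp_zero, exp_lt_exp]; norm_num)

/-- The Gauss map `x ↦ frac (1 / x)` on `𝓗`. -/
def gauss (x : H p) : H p := frac (x : LaurentInv p)⁻¹

/-- Since `0⁻¹ = 0`, the Gauss map fixes `0`, so terminating expansions need no separate case. -/
theorem completeQuotient_succ (L : LaurentInv p) (h : ℕ) :
    completeQuotient L (h + 1) = ((gauss^[h] (frac L) : H p) : LaurentInv p)⁻¹ := by
  induction h with
  | zero => simp [completeQuotient, sub_polyPart_eq_frac]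
  | succ h ih =>
    rw [completeQuotient, sub_polyPart_eq_frac, ih, Function.iterate_succ_apply', gauss]

/-- The leading coefficient of the polynomial part bounds the valuation of `L⁻¹` from below. This
turns a large partial quotient into membership in a cylinder. -/
theorem valuation_le_of_le_natDegree_polyPart_inv {L : LaurentInv p} {d : ℕ}
    (h : d + 1 ≤ (polyPart L⁻¹).natDegree) : Valued.v L ≤ exp (-((d : ℤ) + 1)) := by
  set n := (polyPart L⁻¹).natDegree with hn
  have hc : (L⁻¹).coeff (-(n : ℤ)) ≠ 0 := by
    rw [← coeff_polyPart, hn, Polynomial.coeff_natDegree, Polynomial.leadingCoeff_ne_zero]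
    intro h0
    rw [hn, h0] at h
    simp at h
  rcases eq_or_ne L 0 with rfl | hL
  · simp
  have hv : ¬ Valued.v L⁻¹ ≤ exp (-((-(n : ℤ)) + 1)) := by
    rw [LaurentSeries.valuation_le_iff_coeff_lt_eq_zero]
    intro h
    exact hc (h _ (by omega))
  rw [not_le, map_inv₀] at hv
  have hv0 : Valued.v L ≠ 0 := (Valuation.ne_zero_iff _).2 hL
  rw [← log_le_iff_le_exp hv0]
  rw [← lt_log_iff_exp_lt (inv_ne_zero hv0), log_inv] at hv
  omega

theorem valuation_one_add_mul (c x : H p) :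
    Valued.v (1 + (c : LaurentInv p) * x) = 1 := by
  apply Valuation.map_one_add_of_lt
  rw [map_mul]
  exact (mul_le_of_le_one_right zero_le (valuation_lt_one x).le).trans_lt (valuation_lt_one c)

theorem one_add_mul_ne_zero (c x : H p) : 1 + (c : LaurentInv p) * x ≠ 0 := by
  rw [← Valuation.ne_zero_iff (Valued.v : Valuation (LaurentInv p) _), valuation_one_add_mul]
  exact one_ne_zero

/-- The bijection `x ↦ 1 / (1 / x + c)` of `𝓗`. -/
def invShift (c x : H p) : H p :=
  ⟨(x : LaurentInv p) / (1 + c * x), by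
    rw [mem_H_iff, map_div₀, valuation_one_add_mul, div_one]
    exact mem_H_iff.1 x.2⟩

theorem div_one_add_mul_sub {K : Type*} [Field K] {c x y : K} (hx : 1 + c * x ≠ 0)
    (hy : 1 + c * y ≠ 0) :
    x / (1 + c * x) - y / (1 + c * y) = (x - y) / ((1 + c * x) * (1 + c * y)) := by
  rw [div_sub_div _ _ hx hy]
  congr 1
  ring

theorem div_one_add_mul_leftInverse {K : Type*} [Field K] {c x : K} (hx : 1 + c * x ≠ 0) :
    x / (1 + c * x) / (1 + -c * (x / (1 + c * x))) = x := by
  have : 1 + -c * (x / (1 + c * x)) = 1 / (1 + c * x) := by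
    rw [eq_div_iff hx, add_mul, mul_assoc, div_mul_cancel₀ _ hx]
    ring
  rw [this, div_div_div_cancel_right₀ hx, div_one]

theorem inv_div_one_add_mul {K : Type*} [Field K] {c x : K} (hx : x ≠ 0) :
    (x / (1 + c * x))⁻¹ = c + x⁻¹ := by
  field_simp
  ring

/-- The denominators `1 + c x` and `1 + c y` have valuation one, so `invShift c` is an isometry. -/
theorem valuation_invShift_sub (c x y : H p) :
    Valued.v ((invShift c x : LaurentInv p) - invShift c y) =
      Valued.v ((x : LaurentInv p) - y) := by
  have : (invShift c x : LaurentInv p) - invShift c y =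
      ((x : LaurentInv p) - y) / ((1 + c * x) * (1 + c * y)) :=
    div_one_add_mul_sub (one_add_mul_ne_zero c x) (one_add_mul_ne_zero c y)
  rw [this, map_div₀, map_mul, valuation_one_add_mul, valuation_one_add_mul, mul_one, div_one]

theorem invShift_neg_invShift (c x : H p) : invShift (-c) (invShift c x) = x :=
  Subtype.ext (div_one_add_mul_leftInverse (one_add_mul_ne_zero c x))

/-- In the coordinate `1 / x` the map `invShift c` is translation by `c`. At `x = 0` the convention
`0⁻¹ = 0` breaks this. -/
theorem gauss_invShift (c : H p) {x : H p} (hx : x ≠ 0) :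
    gauss (invShift c x) = c + gauss x := by
  have hx' : (x : LaurentInv p) ≠ 0 := fun h => hx (Subtype.ext h)
  have : ((invShift c x : H p) : LaurentInv p)⁻¹ = c + (x : LaurentInv p)⁻¹ :=
    inv_div_one_add_mul hx'
  rw [gauss, this, frac_add, frac_coe, gauss]

end Algebra

end FunctionFieldCF

end

noncomputable section

namespace FunctionFieldCF

open MeasureTheory WithZero

/-! ### Digits, cylinders and ultrametric balls in `𝓗` -/

section Topology

variable {p : ℕ} [Fact p.Prime]

theorem continuous_coeff (i : ℤ) : Continuous fun L : LaurentInv p => L.coeff i := by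
  let _ : UniformSpace (ZMod p) := ⊥
  exact (LaurentSeries.uniformContinuous_coeff i).continuous

theorem continuous_frac : Continuous (frac : LaurentInv p → H p) :=
  (continuous_ofDigits p).comp (continuous_pi fun _ => continuous_coeff _)

theorem ofDigits_digits (x : H p) :
    ofDigits p (fun n => (x : LaurentInv p).coeff ((n : ℤ) + 1)) = x :=
  frac_coe x

/-- The digit expansion as a homeomorphism. -/
def digitsHomeomorph : (ℕ → ZMod p) ≃ₜ H p where
  toFun := ofDigits p
  invFun x n := (x : LaurentInv p).coeff ((n : ℤ) + 1)
  left_inv a := funext fun n => coeff_ofDigits p a n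
  right_inv := ofDigits_digits
  continuous_toFun := continuous_ofDigits p
  continuous_invFun := continuous_pi fun _ => (continuous_coeff _).comp continuous_subtype_val

instance : SecondCountableTopology (H p) :=
  (digitsHomeomorph (p := p)).symm.secondCountableTopology

/-- The subgroup of all `x ∈ 𝓗` whose first `n` digits vanish. -/
def cylinder (p : ℕ) [Fact p.Prime] (n : ℕ) : AddSubgroup (H p) where
  carrier := {x | ∀ i : ℤ, i ≤ n → (x : LaurentInv p).coeff i = 0}
  zero_mem' := by simp
  add_mem' := by
    intro a b ha hb i hi
    simp [ha i hi, hb i hi]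
  neg_mem' := by
    intro a ha i hi
    simp [ha i hi]

theorem mem_cylinder_iff {n : ℕ} {x : H p} :
    x ∈ cylinder p n ↔ ∀ i : ℤ, i ≤ n → (x : LaurentInv p).coeff i = 0 := Iff.rfl

theorem mem_cylinder_iff_valuation {n : ℕ} {x : H p} :
    x ∈ cylinder p n ↔ Valued.v (x : LaurentInv p) ≤ exp (-((n : ℤ) + 1)) := by
  rw [LaurentSeries.valuation_le_iff_coeff_lt_eq_zero]
  exact ⟨fun h i hi => h i (by omega), fun h i hi => h i (by omega)⟩

theorem cylinder_antitone {m n : ℕ} (h : m ≤ n) : cylinder p n ≤ cylinder p m :=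
  fun _ hx i hi => hx i (by omega)

/-- The set of all `y ∈ 𝓗` that share the first `n` digits of `x`. -/
def ball (x : H p) (n : ℕ) : Set (H p) := {y | y - x ∈ cylinder p n}

theorem mem_ball_iff {x y : H p} {n : ℕ} : y ∈ ball x n ↔
    ∀ k < n, (y : LaurentInv p).coeff ((k : ℤ) + 1) = (x : LaurentInv p).coeff ((k : ℤ) + 1) := by
  rw [ball, Set.mem_ofPred_eq, mem_cylinder_iff]
  constructor
  · intro h k hk
    have := h (k + 1) (by omega)
    rwa [AddSubgroup.coe_sub, HahnSeries.coeff_sub, sub_eq_zero] at this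
  · intro h i hi
    rcases le_or_gt i 0 with hi0 | hi0
    · exact coeff_H_of_nonpos _ hi0
    · obtain ⟨k, rfl⟩ : ∃ n : ℕ, i = (n : ℤ) + 1 := ⟨(i - 1).toNat, by omega⟩
      rw [AddSubgroup.coe_sub, HahnSeries.coeff_sub, sub_eq_zero]
      exact h k (by omega)

theorem mem_ball_self (x : H p) (n : ℕ) : x ∈ ball x n := mem_ball_iff.2 fun _ _ => rfl

theorem ball_eq_of_mem {x y : H p} {n : ℕ} (h : y ∈ ball x n) : ball y n = ball x n := by
  ext z
  rw [mem_ball_iff] at h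
  simp only [mem_ball_iff]
  exact ⟨fun hz k hk => (hz k hk).trans (h k hk), fun hz k hk => (hz k hk).trans (h k hk).symm⟩

theorem ball_antitone (x : H p) {m n : ℕ} (h : m ≤ n) : ball x n ⊆ ball x m :=
  fun _ hy => cylinder_antitone h hy

theorem isOpen_ball (x : H p) (n : ℕ) : IsOpen (ball x n) := by
  have : ball x n = ⋂ k ∈ Finset.range n, (fun y : H p => (y : LaurentInv p).coeff ((k : ℤ) + 1)) ⁻¹'
      {(x : LaurentInv p).coeff ((k : ℤ) + 1)} := by
    ext y
    simp [mem_ball_iff]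
  rw [this]
  exact isOpen_biInter_finset fun k _ => (isOpen_discrete _).preimage
    ((continuous_coeff _).comp continuous_subtype_val)

theorem ball_zero (n : ℕ) : ball (0 : H p) n = cylinder p n := by
  ext x
  simp [ball]

theorem measurableSet_cylinder (n : ℕ) : MeasurableSet (cylinder p n : Set (H p)) := by
  rw [← ball_zero]
  exact (isOpen_ball _ _).measurableSet

theorem exists_ball_subset {x : H p} {U : Set (H p)} (hU : IsOpen U) (hx : x ∈ U) :
    ∃ n, ball x n ⊆ U := by
  have h : digitsHomeomorph ⁻¹' U ∈ nhds (digitsHomeomorph.symm x) :=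
    (hU.preimage digitsHomeomorph.continuous).mem_nhds (by simpa)
  rw [nhds_pi, Filter.mem_pi] at h
  obtain ⟨I, hI, s, hs, hsub⟩ := h
  obtain ⟨n, hn⟩ := hI.bddAbove
  refine ⟨n + 1, fun y hy => ?_⟩
  have hy' : digitsHomeomorph.symm y ∈ digitsHomeomorph ⁻¹' U := by
    refine hsub fun k hk => ?_
    have := mem_ball_iff.1 hy k (Nat.lt_succ_of_le (hn hk))
    change (y : LaurentInv p).coeff ((k : ℤ) + 1) ∈ s k
    rw [this]
    exact mem_of_mem_nhds (hs k)
  simpa using hy'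

theorem isTopologicalBasis_ball :
    TopologicalSpace.IsTopologicalBasis {s : Set (H p) | ∃ x n, s = ball x n} := by
  refine TopologicalSpace.isTopologicalBasis_of_isOpen_of_nhds ?_ ?_
  · rintro _ ⟨x, n, rfl⟩
    exact isOpen_ball x n
  · intro x U hx hU
    obtain ⟨n, hn⟩ := exists_ball_subset hU hx
    exact ⟨_, ⟨x, n, rfl⟩, mem_ball_self x n, hn⟩

/-- Every point of a ball is a centre, so two balls that meet are nested. -/
theorem isPiSystem_ball : IsPiSystem {s : Set (H p) | ∃ x n, s = ball x n} := by
  rintro _ ⟨x, m, rfl⟩ _ ⟨y, n, rfl⟩ ⟨z, hzx, hzy⟩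
  rw [← ball_eq_of_mem hzx, ← ball_eq_of_mem hzy]
  rcases le_total m n with h | h
  · exact ⟨z, n, Set.inter_eq_right.2 (ball_antitone z h)⟩
  · exact ⟨z, m, Set.inter_eq_left.2 (ball_antitone z h)⟩

theorem continuous_invShift (c : H p) : Continuous (invShift c) := by
  refine Continuous.subtype_mk ?_ _
  exact continuous_subtype_val.div (by fun_prop) fun x => one_add_mul_ne_zero c x

theorem measurable_gauss : Measurable (gauss : H p → H p) := by
  refine measurable_of_continuousOn_compl_singleton 0 ?_
  refine continuous_frac.comp_continuousOn (continuous_subtype_val.continuousOn.inv₀ ?_)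
  exact fun x hx h => hx (Subtype.ext h)

theorem preimage_invShift_ball (c x : H p) (n : ℕ) :
    invShift c ⁻¹' ball x n = ball (invShift (-c) x) n := by
  ext y
  have hx : invShift c (invShift (-c) x) = x := by
    simpa using invShift_neg_invShift (-c) x
  simp only [Set.mem_preimage, ball, Set.mem_ofPred_eq, mem_cylinder_iff_valuation,
    AddSubgroup.coe_sub]
  rw [← valuation_invShift_sub c y, hx]

end Topology

/-! ### Invariance of Haar measure and the tail bound -/

section Measure

variable {p : ℕ} [Fact p.Prime]

instance : (haarH p).IsAddHaarMeasure := by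
  unfold haarH
  infer_instance

instance : IsProbabilityMeasure (haarH p) := by
  constructor
  exact Measure.addHaarMeasure_self (K₀ := (⊤ : TopologicalSpace.PositiveCompacts (H p)))

theorem haarH_ball (x : H p) (n : ℕ) : haarH p (ball x n) = haarH p (cylinder p n) := by
  have : ball x n = (fun y => y + (-x)) ⁻¹' (cylinder p n : Set (H p)) := by
    ext y
    simp [ball, sub_eq_add_neg]
  rw [this, measure_preimage_add_right]

/-- The measure of a ball depends only on `n`, and balls form a generating π-system. -/
theorem measurePreserving_of_isometry {f g : H p → H p} (hf : Continuous f)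
    (h : ∀ x n, f ⁻¹' ball x n = ball (g x) n) : MeasurePreserving f (haarH p) (haarH p) := by
  refine ⟨hf.measurable, ?_⟩
  have : IsProbabilityMeasure ((haarH p).map f) :=
    Measure.isProbabilityMeasure_map hf.measurable.aemeasurable
  refine ext_of_generate_finite _ (BorelSpace.measurable_eq.trans
    isTopologicalBasis_ball.borel_eq_generateFrom) isPiSystem_ball ?_ (by simp)
  rintro _ ⟨x, n, rfl⟩
  rw [Measure.map_apply hf.measurable (isOpen_ball x n).measurableSet, h, haarH_ball, haarH_ball]

theorem measurePreserving_invShift (c : H p) :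
    MeasurePreserving (invShift c) (haarH p) (haarH p) :=
  measurePreserving_of_isometry (continuous_invShift c) (preimage_invShift_ball c)

/-- The element `a X^{-(n+1)}` of `𝓗`. -/
def digitAt (n : ℕ) (a : ZMod p) : H p := ofDigits p (Pi.single n a)

/-- The `p` choices of the next digit give disjoint translates of the smaller cylinder inside the
larger one. -/
theorem haarH_cylinder_succ_le (n : ℕ) :
    (p : ENNReal) * haarH p (cylinder p (n + 1)) ≤ haarH p (cylinder p n) := by
  have hcoeff : ∀ (a : ZMod p) (k : ℕ), (digitAt n a : LaurentInv p).coeff ((k : ℤ) + 1) =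
      (Pi.single n a : ℕ → ZMod p) k := fun a k => coeff_ofDigits p _ k
  have hdisj : Pairwise (Function.onFun Disjoint fun a : ZMod p => ball (digitAt n a) (n + 1)) := by
    intro a b hab
    refine Set.disjoint_left.2 fun x hx hy => hab ?_
    have h1 := mem_ball_iff.1 hx n (by omega)
    have h2 := mem_ball_iff.1 hy n (by omega)
    rw [hcoeff, Pi.single_eq_same] at h1 h2
    exact h1.symm.trans h2
  have hsub : (⋃ a : ZMod p, ball (digitAt n a) (n + 1)) ⊆ cylinder p n := by
    refine Set.iUnion_subset fun a x hx => ?_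
    rw [← ball_zero, mem_ball_iff]
    intro k hk
    rw [mem_ball_iff.1 hx k (by omega), hcoeff, Pi.single_eq_of_ne (by omega)]
    simp
  refine le_trans (le_of_eq ?_) (measure_mono hsub)
  rw [measure_iUnion hdisj fun a => (isOpen_ball _ _).measurableSet, tsum_fintype]
  simp [haarH_ball, ZMod.card]

theorem haarH_cylinder_le (n : ℕ) :
    haarH p (cylinder p n) ≤ ENNReal.ofReal ((p : ℝ)⁻¹ ^ n) := by
  have hp : (0 : ℝ) < p := by exact_mod_cast (Fact.out : p.Prime).pos
  induction n with
  | zero => simpa using prob_le_one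
  | succ n ih =>
    have h := (haarH_cylinder_succ_le n).trans ih
    rw [mul_comm, ← ENNReal.le_div_iff_mul_le (Or.inl (by exact_mod_cast hp.ne'))
      (Or.inl (ENNReal.natCast_ne_top p))] at h
    refine h.trans_eq ?_
    rw [← ENNReal.ofReal_natCast, ← ENNReal.ofReal_div_of_pos hp, pow_succ, div_eq_mul_inv]

theorem haarH_singleton_zero : haarH p {0} = 0 := by
  have hp : (1 : ℝ) < p := by exact_mod_cast (Fact.out : p.Prime).one_lt
  have h : ∀ n, haarH p {0} ≤ ENNReal.ofReal ((p : ℝ)⁻¹ ^ n) := fun n =>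
    (measure_mono (by simp)).trans (haarH_cylinder_le n)
  have ht := ENNReal.tendsto_ofReal
    (tendsto_pow_atTop_nhds_zero_of_lt_one (by positivity) (inv_lt_one_of_one_lt₀ hp))
  rw [ENNReal.ofReal_zero] at ht
  exact le_antisymm (ge_of_tendsto' ht h) zero_le

/-- The Gauss map preserves Haar measure. -/
theorem measurePreserving_gauss :
    MeasurePreserving (gauss : H p → H p) (haarH p) (haarH p) := by
  refine ⟨measurable_gauss, ?_⟩
  have hprob : IsProbabilityMeasure ((haarH p).map gauss) :=
    Measure.isProbabilityMeasure_map measurable_gauss.aemeasurable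
  -- Translating the image by `c` amounts to precomposing with `invShift c`, which preserves Haar
  -- measure; uniqueness of Haar measure then identifies the image.
  have hinv : ((haarH p).map gauss).IsAddLeftInvariant := by
    refine ⟨fun c => ?_⟩
    rw [Measure.map_map (measurable_const_add c) measurable_gauss]
    conv_rhs => rw [← (measurePreserving_invShift c).map_eq,
      Measure.map_map measurable_gauss (continuous_invShift c).measurable]
    -- The conjugation identity can fail only at the origin, a null set.
    refine Measure.map_congr ?_
    filter_upwards [measure_eq_zero_iff_ae_notMem.1 (haarH_singleton_zero (p := p))] with x hx
    exact (gauss_invShift c hx).symm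
  have h := Measure.addHaarMeasure_unique ((haarH p).map gauss) ⊤
  have h1 : (haarH p).map gauss ((⊤ : TopologicalSpace.PositiveCompacts (H p)) : Set (H p)) = 1 :=
    hprob.measure_univ
  rw [h, h1, one_smul, haarH]

/-- Multiplication by a nonzero polynomial, modulo polynomials. -/
def mulFrac (P : (ZMod p)[X]) : H p →+ H p where
  toFun x := frac (polyToLaurent P * x)
  map_zero' := by
    simpa using frac_polyToLaurent (0 : (ZMod p)[X])
  map_add' x y := by rw [AddSubgroup.coe_add, mul_add, frac_add]

theorem measurePreserving_mulFrac {P : (ZMod p)[X]} (hP : P ≠ 0) :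
    MeasurePreserving (mulFrac P) (haarH p) (haarH p) := by
  -- A continuous surjective endomorphism of a compact group preserves Haar measure. For
  -- surjectivity, divide by `P` and drop the polynomial part, which contributes only a polynomial
  -- after multiplication.
  refine AddMonoidHom.measurePreserving ?_ ?_ rfl
  · exact continuous_frac.comp (continuous_const.mul continuous_subtype_val)
  · intro y
    set L : LaurentInv p := (polyToLaurent P)⁻¹ * y
    refine ⟨frac L, ?_⟩
    have h : polyToLaurent P * L =
        polyToLaurent P * (frac L : LaurentInv p) + polyToLaurent (P * polyPart L) := by
      rw [← sub_polyPart_eq_frac, map_mul]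
      ring
    have h' := congrArg frac h
    rw [frac_add, frac_polyToLaurent, add_zero,
      mul_inv_cancel_left₀ (polyToLaurent_ne_zero hP), frac_coe] at h'
    exact h'.symm

theorem haarH_natDegree_cfCoeff_ge {P : (ZMod p)[X]} (hP : P ≠ 0) {h : ℕ} (hh : 1 ≤ h) (d : ℕ) :
    haarH p {L : H p | d + 1 ≤ (cfCoeff (polyToLaurent P * (L : LaurentInv p)) h).natDegree} ≤
      ENNReal.ofReal ((p : ℝ)⁻¹ ^ d) := by
  obtain ⟨k, rfl⟩ : ∃ k, h = k + 1 := ⟨h - 1, by omega⟩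
  have hmp := (measurePreserving_gauss.iterate k).comp (measurePreserving_mulFrac hP)
  refine le_trans ?_ (haarH_cylinder_le d)
  rw [← hmp.measure_preimage (measurableSet_cylinder d).nullMeasurableSet]
  refine measure_mono fun L hL => ?_
  rw [Set.mem_ofPred_eq, cfCoeff, completeQuotient_succ] at hL
  exact mem_cylinder_iff_valuation.2 (valuation_le_of_le_natDegree_polyPart_inv hL)

end Measure

end FunctionFieldCF

end

/-! ### Sums of heavy-tailed variables without independence -/

section HeavyTails

open MeasureTheory
open scoped ENNReal

theorem rpow_mul_pow_le {q s : ℝ} (hq : 1 < q) (hs0 : 0 < s) (hs1 : s ≤ 1) (d : ℕ) :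
    ((d : ℝ) * q ^ d) ^ s ≤ d * (q ^ s) ^ d := by
  have hq0 : 0 ≤ q := by linarith
  rw [Real.mul_rpow (by positivity) (by positivity), ← Real.rpow_pow_comm hq0]
  gcongr
  rcases Nat.eq_zero_or_pos d with rfl | hd
  · simp [Real.zero_rpow hs0.ne']
  · exact (Real.rpow_le_rpow_of_exponent_le (by exact_mod_cast hd) hs1).trans_eq (Real.rpow_one _)

theorem summable_moment {q s : ℝ} (hq : 1 < q) (hs1 : s < 1) :
    Summable fun d : ℕ => ((d + 1 : ℕ) : ℝ) * (q ^ s) ^ (d + 1) * q⁻¹ ^ d := by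
  have hq0 : 0 < q := by linarith
  have hr : ‖q ^ s * q⁻¹‖ < 1 := by
    rw [Real.norm_of_nonneg (by positivity), ← Real.rpow_neg_one, ← Real.rpow_add hq0]
    exact Real.rpow_lt_one_of_one_lt_of_neg hq (by linarith)
  have h := (summable_pow_mul_geometric_of_norm_lt_one 1 hr).add
    (summable_geometric_of_norm_lt_one hr)
  refine (h.mul_left (q ^ s)).congr fun d => ?_
  rw [mul_pow, pow_succ]
  push_cast
  ring

/-- Uniformly geometric tails of exponent one give uniformly bounded moments of order `s < 1`. -/
theorem exists_lintegral_moment_le {Ω : Type*} [MeasurableSpace Ω] {q s : ℝ} (hq : 1 < q)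
    (hs1 : s < 1) :
    ∃ K : ℝ≥0∞, K ≠ ∞ ∧ ∀ (μ : Measure Ω) (D : Ω → ℕ),
      (∀ d : ℕ, μ {ω | d + 1 ≤ D ω} ≤ ENNReal.ofReal (q⁻¹ ^ d)) →
      ∃ G : Ω → ℝ≥0∞, Measurable G ∧ (∀ ω, ENNReal.ofReal (D ω * (q ^ s) ^ D ω) ≤ G ω) ∧
        ∫⁻ ω, G ω ∂μ ≤ K := by
  have hq0 : 0 < q := by linarith
  refine ⟨∑' d : ℕ, ENNReal.ofReal (((d + 1 : ℕ) : ℝ) * (q ^ s) ^ (d + 1) * q⁻¹ ^ d),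
    (summable_moment hq hs1).tsum_ofReal_ne_top, fun μ D hD => ?_⟩
  -- Measurable hulls have the same measure, so no measurability of `D` is required; `G` is a
  -- measurable majorant.
  let E : ℕ → Set Ω := fun d => toMeasurable μ {ω | d + 1 ≤ D ω}
  have hE : ∀ d, MeasurableSet (E d) := fun d => measurableSet_toMeasurable _ _
  let F : ℕ → ℝ≥0∞ := fun d => ENNReal.ofReal (((d + 1 : ℕ) : ℝ) * (q ^ s) ^ (d + 1))
  refine ⟨fun ω => ∑' d, (E d).indicator (fun _ => F d) ω, ?_, fun ω => ?_, ?_⟩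
  · exact Measurable.tsum fun d => measurable_const.indicator (hE d)
  · rcases Nat.eq_zero_or_pos (D ω) with h | h
    · simp [h]
    · obtain ⟨d, hd⟩ : ∃ d, D ω = d + 1 := ⟨D ω - 1, by omega⟩
      refine le_trans ?_ (ENNReal.le_tsum d)
      have : ω ∈ E d := subset_toMeasurable _ _ (by simp [hd])
      rw [Set.indicator_of_mem this, hd]
  · rw [lintegral_tsum fun d => (measurable_const.indicator (hE d)).aemeasurable]
    refine ENNReal.tsum_le_tsum fun d => ?_
    rw [lintegral_indicator_const (hE d), measure_toMeasurable,
      ENNReal.ofReal_mul (by positivity)]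
    exact mul_le_mul_right (hD d) _

/-- Subadditivity of `x ^ s` for `s ≤ 1`, iterated over the sum. -/
theorem sum_rpow_le_of_rpow {ι : Type*} (S : Finset ι) (X : ι → ℝ) (hX : ∀ i ∈ S, 0 ≤ X i)
    {s : ℝ} (hs0 : 0 < s) (hs1 : s ≤ 1) :
    ∑ i ∈ S, X i ≤ (∑ i ∈ S, X i ^ s) ^ s⁻¹ := by
  have h : (∑ i ∈ S, X i) ^ s ≤ ∑ i ∈ S, X i ^ s := by
    classical
    induction S using Finset.induction_on with
    | empty => simp [Real.zero_rpow hs0.ne']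
    | insert a S ha ih =>
      rw [Finset.sum_insert ha, Finset.sum_insert ha]
      have h1 := hX a (Finset.mem_insert_self _ _)
      have h2 : ∀ i ∈ S, 0 ≤ X i := fun i hi => hX i (Finset.mem_insert_of_mem hi)
      exact (Real.rpow_add_le_add_rpow h1 (Finset.sum_nonneg h2) hs0.le hs1).trans
        (by gcongr; exact ih h2)
  have h0 := Finset.sum_nonneg hX
  calc ∑ i ∈ S, X i = ((∑ i ∈ S, X i) ^ s) ^ s⁻¹ := by
        rw [← Real.rpow_mul h0, mul_inv_cancel₀ hs0.ne', Real.rpow_one]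
    _ ≤ _ := by
        gcongr

/-- Almost sure growth of sums, over boxes of dimension `n`, of heavy-tailed variables `D * q ^ D`
with `P (D > d) ≤ q ^ (-d)`; nothing is assumed on their joint law. -/
theorem ae_exists_sum_mul_pow_le {Ω ι : Type*} [MeasurableSpace Ω] (μ : Measure Ω) {q : ℝ}
    (hq : 1 < q) (n : ℕ) (I : ℕ → Finset ι) (hI : Monotone I) (hcard : ∀ M, (I M).card ≤ M ^ n)
    (D : ι → Ω → ℕ)
    (hD : ∀ M, ∀ i ∈ I M, ∀ d : ℕ, μ {ω | d + 1 ≤ D i ω} ≤ ENNReal.ofReal (q⁻¹ ^ d))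
    {ε : ℝ} (hε : 0 < ε) :
    ∀ᵐ ω ∂μ, ∃ C : ℝ, 0 ≤ C ∧ ∀ M : ℕ, 1 ≤ M →
      ∑ i ∈ I M, (D i ω : ℝ) * q ^ D i ω ≤ C * (M : ℝ) ^ ((n : ℝ) + ε) := by
  have hq0 : 0 < q := by linarith
  -- Chosen so that `s < 1` and `(n + ε / 2) / s = n + ε`.
  set s : ℝ := (n + ε / 2) / (n + ε) with hs
  have hnε : 0 < (n : ℝ) + ε := by positivity
  have hs0 : 0 < s := by positivity
  have hs1 : s < 1 := by rw [hs, div_lt_one hnε]; linarith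
  obtain ⟨K, hK, hKG⟩ := exists_lintegral_moment_le (Ω := Ω) hq hs1
  have hG : ∀ i : ι, ∃ G : Ω → ℝ≥0∞, Measurable G ∧
      (∀ ω, ENNReal.ofReal (D i ω * (q ^ s) ^ D i ω) ≤ G ω) ∧
      ((∃ M, i ∈ I M) → ∫⁻ ω, G ω ∂μ ≤ K) := by
    intro i
    by_cases hi : ∃ M, i ∈ I M
    · obtain ⟨M, hM⟩ := hi
      obtain ⟨G, h1, h2, h3⟩ := hKG μ (D i) (hD M i hM)
      exact ⟨G, h1, h2, fun _ => h3⟩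
    · exact ⟨fun _ => ∞, measurable_const, fun _ => le_top, fun h => absurd h hi⟩
  choose G hGm hGD hGK using hG
  -- Against at most `2 ^ (k n)` terms of mean at most `K`, these weights leave a geometric series
  -- of ratio `2 ^ (-ε / 2)`.
  set w : ℕ → ℝ≥0∞ := fun k => ENNReal.ofReal (((2 : ℝ) ^ k) ^ (-((n : ℝ) + ε / 2))) with hw
  set W : Ω → ℝ≥0∞ := fun ω => ∑' k, w k * ∑ i ∈ I (2 ^ k), G i ω with hW
  have hsm : ∀ k, Measurable fun ω => ∑ i ∈ I (2 ^ k), G i ω :=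
    fun k => Finset.measurable_fun_sum _ fun i _ => hGm i
  have hWm : Measurable W := Measurable.tsum fun k => (hsm k).const_mul _
  have hWint : ∫⁻ ω, W ω ∂μ ≠ ∞ := by
    rw [hW, lintegral_tsum fun k => ((hsm k).const_mul _).aemeasurable]
    have hterm : ∀ k, ∫⁻ ω, w k * ∑ i ∈ I (2 ^ k), G i ω ∂μ ≤
        ENNReal.ofReal (((2 : ℝ) ^ (-(ε / 2))) ^ k) * K := by
      intro k
      rw [lintegral_const_mul _ (hsm k), lintegral_finsetSum _ fun i _ => hGm i]
      have h1 : ∑ i ∈ I (2 ^ k), ∫⁻ ω, G i ω ∂μ ≤ ENNReal.ofReal (((2 : ℝ) ^ k) ^ n) * K := by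
        refine (Finset.sum_le_card_nsmul _ _ K fun i hi => hGK i ⟨_, hi⟩).trans ?_
        rw [nsmul_eq_mul]
        gcongr
        rw [← ENNReal.ofReal_natCast]
        apply ENNReal.ofReal_le_ofReal
        exact_mod_cast hcard (2 ^ k)
      refine (mul_le_mul_right h1 _).trans_eq ?_
      rw [← mul_assoc, hw, ← ENNReal.ofReal_mul (by positivity)]
      congr 2
      rw [← Real.rpow_natCast _ n, ← Real.rpow_add (by positivity),
        Real.rpow_pow_comm (by norm_num)]
      congr 1
      ring
    refine ne_top_of_le_ne_top ?_ (ENNReal.tsum_le_tsum hterm)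
    rw [ENNReal.tsum_mul_right]
    refine ENNReal.mul_ne_top (Summable.tsum_ofReal_ne_top ?_) hK
    exact summable_geometric_of_lt_one (by positivity)
      (Real.rpow_lt_one_of_one_lt_of_neg (by norm_num) (by linarith))
  filter_upwards [ae_lt_top hWm hWint] with ω hω
  refine ⟨((W ω).toReal * 2 ^ ((n : ℝ) + ε / 2)) ^ s⁻¹, by positivity, fun M hM => ?_⟩
  -- Passing to a power of two between `M` and `2 M` costs only a constant factor.
  set k := Nat.log 2 M + 1
  have hk1 : M ≤ 2 ^ k := (Nat.lt_pow_succ_log_self (by norm_num) M).le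
  have hk2 : (2 : ℝ) ^ k ≤ 2 * M := by
    have := Nat.pow_log_le_self 2 (show M ≠ 0 by omega)
    rw [pow_succ, mul_comm]
    gcongr
    exact_mod_cast this
  have hsum : ∑ i ∈ I M, ((D i ω : ℝ) * q ^ D i ω) ^ s ≤
      (W ω).toReal * ((2 : ℝ) ^ k) ^ ((n : ℝ) + ε / 2) := by
    have hreal : ∑ i ∈ I M, ((D i ω : ℝ) * q ^ D i ω) ^ s ≤
        ∑ i ∈ I (2 ^ k), (D i ω : ℝ) * (q ^ s) ^ D i ω :=
      (Finset.sum_le_sum fun i _ => rpow_mul_pow_le hq hs0 hs1.le _).trans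
        (Finset.sum_le_sum_of_subset_of_nonneg (hI hk1) fun i _ _ => by positivity)
    have hen : w k * ENNReal.ofReal (∑ i ∈ I (2 ^ k), (D i ω : ℝ) * (q ^ s) ^ D i ω) ≤ W ω := by
      refine le_trans ?_ (ENNReal.le_tsum k)
      rw [ENNReal.ofReal_sum_of_nonneg fun i _ => by positivity]
      gcongr with i _
      exact hGD i ω
    rw [hw, ← ENNReal.ofReal_mul (by positivity), ENNReal.ofReal_le_iff_le_toReal hω.ne,
      Real.rpow_neg (by positivity), inv_mul_le_iff₀ (by positivity)] at hen
    exact hreal.trans (hen.trans_eq (mul_comm _ _))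
  have hM0 : (0 : ℝ) < M := by exact_mod_cast hM
  calc ∑ i ∈ I M, (D i ω : ℝ) * q ^ D i ω
      ≤ (∑ i ∈ I M, ((D i ω : ℝ) * q ^ D i ω) ^ s) ^ s⁻¹ :=
        sum_rpow_le_of_rpow _ _ (fun i _ => by positivity) hs0 hs1.le
    _ ≤ ((W ω).toReal * (2 * (M : ℝ)) ^ ((n : ℝ) + ε / 2)) ^ s⁻¹ := by
        refine Real.rpow_le_rpow (Finset.sum_nonneg fun i _ => by positivity) ?_ (by positivity)
        exact hsum.trans (by gcongr)
    _ = _ := by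
        rw [Real.mul_rpow (by norm_num) hM0.le, ← mul_assoc,
          Real.mul_rpow (by positivity) (by positivity), ← Real.rpow_mul hM0.le]
        congr 2
        rw [hs]
        field_simp

end HeavyTails

/-! ### The metric theorem -/

theorem proposition3 (p : ℕ) [Fact p.Prime] (t : ℕ) (ht : 1 ≤ t)
    (b : Fin t → Polynomial (ZMod p))
    (hmonic : ∀ j, (b j).Monic)
    (hnonconst : ∀ j, 1 ≤ (b j).natDegree)
    (hcoprime : Pairwise fun i j => IsCoprime (b i) (b j)) :
    ∀ᵐ L : FunctionFieldCF.H p ∂(FunctionFieldCF.haarH p), ∀ ε : ℝ, 0 < ε → ∃ C : ℝ, ∀ N : ℕ, 1 < N →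
      ∑ h ∈ Finset.Icc 1 (Nat.log p N),
        ∑ l ∈ Fintype.piFinset (fun _ : Fin t => Finset.Icc 1 (Nat.log p N)),
          ((FunctionFieldCF.cfCoeff
              (FunctionFieldCF.polyToLaurent (∏ j, b j ^ l j) * (L : FunctionFieldCF.LaurentInv p))
              h).natDegree : ℝ) *
            (p : ℝ) ^ (FunctionFieldCF.cfCoeff
              (FunctionFieldCF.polyToLaurent (∏ j, b j ^ l j) * (L : FunctionFieldCF.LaurentInv p))
              h).natDegree
        ≤ C * Real.log N ^ ((t : ℝ) + 1 + ε) := by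
  have hp : (1 : ℝ) < p := by exact_mod_cast (Fact.out : p.Prime).one_lt
  let I : ℕ → Finset (ℕ × (Fin t → ℕ)) := fun M =>
    Finset.Icc 1 M ×ˢ Fintype.piFinset fun _ => Finset.Icc 1 M
  have hI : Monotone I := fun M M' h => Finset.product_subset_product
    (Finset.Icc_subset_Icc_right h) (Fintype.piFinset_subset _ _ fun _ => Finset.Icc_subset_Icc_right h)
  have hcard : ∀ M, (I M).card ≤ M ^ (t + 1) := fun M => by
    simp [I, Fintype.card_piFinset, pow_succ, mul_comm]
  let D : ℕ × (Fin t → ℕ) → FunctionFieldCF.H p → ℕ := fun i L =>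
    (FunctionFieldCF.cfCoeff (FunctionFieldCF.polyToLaurent (∏ j, b j ^ i.2 j) *
      (L : FunctionFieldCF.LaurentInv p)) i.1).natDegree
  have hD : ∀ M, ∀ i ∈ I M, ∀ d : ℕ, FunctionFieldCF.haarH p {L | d + 1 ≤ D i L} ≤
      ENNReal.ofReal ((p : ℝ)⁻¹ ^ d) := by
    intro M i hi d
    have hb : (∏ j, b j ^ i.2 j) ≠ 0 :=
      Finset.prod_ne_zero_iff.2 fun j _ => pow_ne_zero _ (hmonic j).ne_zero
    exact FunctionFieldCF.haarH_natDegree_cfCoeff_ge hb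
      (Finset.mem_Icc.1 (Finset.mem_product.1 hi).1).1 d
  -- Countably many exponents `1 / (m + 1)` suffice, so a single null set serves every `ε`.
  have hae : ∀ᵐ L ∂(FunctionFieldCF.haarH p), ∀ m : ℕ, ∃ C : ℝ, 0 ≤ C ∧ ∀ M : ℕ, 1 ≤ M →
      ∑ i ∈ I M, (D i L : ℝ) * (p : ℝ) ^ D i L ≤
        C * (M : ℝ) ^ (((t + 1 : ℕ) : ℝ) + 1 / ((m : ℝ) + 1)) :=
    MeasureTheory.ae_all_iff.2 fun m => ae_exists_sum_mul_pow_le _ hp (t + 1) I hI hcard D hD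
      Nat.one_div_pos_of_nat
  filter_upwards [hae] with L hL ε hε
  obtain ⟨m, hm⟩ := exists_nat_one_div_lt hε
  obtain ⟨C, hC0, hC⟩ := hL m
  have hlogp : 0 < Real.log p := Real.log_pos hp
  refine ⟨C / Real.log p ^ ((t : ℝ) + 1 + ε), fun N hN => ?_⟩
  have hlogN : 0 < Real.log N := Real.log_pos (by exact_mod_cast hN)
  rw [← Finset.sum_product' (Finset.Icc 1 (Nat.log p N)) _ fun h l => (D (h, l) L : ℝ) *
    (p : ℝ) ^ D (h, l) L]
  -- For `N < p` the sum is empty, and `0 ≤ C` settles the bound.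
  rcases Nat.eq_zero_or_pos (Nat.log p N) with h0 | hM
  · rw [h0]
    simp only [Finset.Icc_eq_empty_of_lt zero_lt_one, Finset.empty_product, Finset.sum_empty]
    positivity
  · refine (hC _ hM).trans ?_
    have hM1 : (1 : ℝ) ≤ Nat.log p N := by exact_mod_cast hM
    have hMlog : (Nat.log p N : ℝ) ≤ Real.log N / Real.log p := Real.natLog_le_logb N p
    rw [div_mul_eq_mul_div, mul_div_assoc, ← Real.div_rpow hlogN.le hlogp.le]
    gcongr
    refine (Real.rpow_le_rpow_of_exponent_le hM1 ?_).trans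
      (Real.rpow_le_rpow (by linarith) hMlog (by positivity))
    push_cast
    linarith
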